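/- \textbf{Conventions.} For a finite alphabet $\Sigma$ (of indices of modalities), modal formulas over $\Sigma$ are built from $\bot$, propositional letters $p_0,p_1,\dots$, implication, and boxes $[e]$, $e\in\Sigma$. A $\Sigma$-frame is $F=(W,(R_e)_{e\in\Sigma})$ with $W\neq\varnothing$ and $R_e\subseteq W\times W$; truth in models on $F$ is Kripke truth, and $F\models\varphi$ ($\varphi$ is valid on $F$) means that $\varphi$ is true at all points under all valuations. A (normal) logic over $\Sigma$ is a set of formulas containing all classical tautologies and all $[e](p\to q)\to([e]p\to[e]q)$, closed under modus ponens, substitution and necessitation. For a set $\Phi$ of formulas over $\Sigma$, $\mathbf K_\Sigma+\Phi$ is the smallest logic over $\Sigma$ containing $\Phi$. A logic has the \emph{finite model property} if it is the set of all formulas valid on every frame of some class of finite frames. \textbf{Canonicity.} The canonical frame $F_L$ of a logic $L$ has as points the sets $x\supseteq L$ of formulas that are closed under modus ponens, never contain both $\varphi$ and $\neg\varphi$, and always contain one of them; $x\,R_e\,y$ iff $[e]\varphi\in x$ implies $\varphi\in y$ for all $\varphi$. $L$ is canonical if all its formulas are valid on $F_L$; a formula $\varphi$ over $\Sigma$ is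 canonical if $\mathbf K_\Sigma+\{\varphi\}$ is. \textbf{MFP.} $\mathrm{MFP}$ is the smallest set of first-order formulas (with equality and binary relation symbols $R_e$, $e\in\Sigma$) that contains all atoms $R_e(x,y)$ and $x=y$ and is closed under $\wedge$, $\vee$, $\forall v$, $\exists v$, and under passing from $B$ to $\forall x\forall y(R_e(x,y)\to B)$ and to $\forall x\forall y(x=y\to B)$, where $x,y$ are distinct variables. A modal formula $\varphi$ is a \emph{modal $\mathrm{MFP}$-formula} if there is $B\in\mathrm{MFP}$ such that for every $\Sigma$-frame $F$: $F\models\varphi$ iff $B$ is true in $F$ (under all assignments). \textbf{Fusion.} For logics $L_1,\dots,L_k$ over finite, pairwise disjoint alphabets $\Sigma_1,\dots,\Sigma_k$, the fusion $L_1*\dots*L_k$ is the smallest logic over $\Sigma_1\cup\dots\cup\Sigma_k$ containing $L_1\cup\dots\cup L_k$. \textbf{Expansions.} Let $\Sigma^\sharp$ be $\Sigma$ together with new symbols $e\circ f$, $e\cup f$, $e^+$ for $e,f\in\Sigma$. For a logic $L$ over $\Sigma$ let $L^\sharp$ be the smallest logic over $\Sigma^\sharp$ containing $L$ and, for all $e,c\in\Sigma$,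 the axioms $$[e\cup c]p\leftrightarrow[e]p\wedge[c]p,\quad [e\circ c]p\leftrightarrow[e][c]p,\quad [e^+]p\to[e]p,\quad [e^+]p\to[e][e^+]p,\quad [e^+](p\to[e]p)\to([e]p\to[e^+]p).$$ Put $L^{(0)}=L$ and $L^{(n+1)}=(L^{(n)})^\sharp$. \textbf{Corollary.} Let each of $L_1,\dots,L_k$ be either one of the unimodal logics $\mathbf K$, $\mathbf T$, $\mathbf{K4}$, $\mathbf{S4}$, $\mathbf{S5}$ (the extensions of the smallest unimodal logic by, respectively, no axiom; $\Box p\to p$; $\Box p\to\Box\Box p$; both of these; both of these and $p\to\Box\Diamond p$), or a logic of the form $\mathbf K_\Sigma+\Phi$, where $\Sigma$ is a finite alphabet and $\Phi$ is a (possibly infinite) set of canonical modal $\mathrm{MFP}$-formulas over $\Sigma$. Then for every $n<\omega$ the logic $(L_1*\dots*L_k)^{(n)}$ has the finite model property. -/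

import Mathlib

namespace PDLization

/-! ### Modal formulas, Kripke semantics -/

/-- Modal formulas over an alphabet `A` of modality indices; propositional letters are `ℕ`. -/
inductive Formula (A : Type) : Type where
  | bot : Formula A
  | var : ℕ → Formula A
  | imp : Formula A → Formula A → Formula A
  | box : A → Formula A → Formula A

namespace Formula

variable {A B : Type}

def neg (φ : Formula A) : Formula A := imp φ bot

def and (φ ψ : Formula A) : Formula A := neg (imp φ (neg ψ))

def iff (φ ψ : Formula A) : Formula A := and (imp φ ψ) (imp ψ φ)

def dia (e : A) (φ : Formula A) : Formula A := neg (box e (neg φ))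

/-- Simultaneous substitution of formulas for propositional letters. -/
def subst (σ : ℕ → Formula A) : Formula A → Formula A
  | bot => bot
  | var n => σ n
  | imp φ ψ => imp (subst σ φ) (subst σ ψ)
  | box e φ => box e (subst σ φ)

/-- Renaming of modality indices; along an injection this regards a formula over a smaller
alphabet as a formula over a bigger one. -/
def map (f : A → B) : Formula A → Formula B
  | bot => bot
  | var n => var n
  | imp φ ψ => imp (map f φ) (map f ψ)
  | box e φ => box (f e) (map f φ)

/-- Boolean evaluation, where letters and boxed formulas are treated as atoms. -/
def boolEval (v : Formula A → Prop) : Formula A → Prop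
  | bot => False
  | var n => v (var n)
  | imp φ ψ => boolEval v φ → boolEval v ψ
  | box e φ => v (box e φ)

/-- (Instances of) classical tautologies. -/
def IsTautology (φ : Formula A) : Prop := ∀ v : Formula A → Prop, boolEval v φ

/-- Truth at a point of the model `(W, R, V)`. -/
def Sat {W : Type} (R : A → W → W → Prop) (V : ℕ → W → Prop) : Formula A → W → Prop
  | bot, _ => False
  | var n, x => V n x
  | imp φ ψ, x => Sat R V φ x → Sat R V ψ x
  | box e φ, x => ∀ y, R e x y → Sat R V φ y

/-- Validity on `(W, R)`: truth at all points under all valuations. -/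
def ValidOn {W : Type} (R : A → W → W → Prop) (φ : Formula A) : Prop :=
  ∀ (V : ℕ → W → Prop) (x : W), Sat R V φ x

end Formula

open Formula

/-- A Kripke frame over `A`: a nonempty set with one binary relation for each index. -/
structure Frame (A : Type) where
  W : Type
  nonempty : Nonempty W
  rel : A → W → W → Prop

def Frame.Valid {A : Type} (F : Frame A) (φ : Formula A) : Prop := ValidOn F.rel φ

/-! ### Normal logics -/

/-- Normal modal logics over `A`. -/
structure IsNormalLogic {A : Type} (L : Set (Formula A)) : Prop where
  taut : ∀ φ, IsTautology φ → φ ∈ L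
  axK : ∀ e : A,
    imp (box e (imp (var 0) (var 1))) (imp (box e (var 0)) (box e (var 1))) ∈ L
  mp : ∀ φ ψ, imp φ ψ ∈ L → φ ∈ L → ψ ∈ L
  substitution : ∀ (σ : ℕ → Formula A) φ, φ ∈ L → subst σ φ ∈ L
  nec : ∀ (e : A) φ, φ ∈ L → box e φ ∈ L

/-- The smallest normal logic over `A` that contains the set of formulas `X`. -/
def leastLogic {A : Type} (X : Set (Formula A)) : Set (Formula A) :=
  {φ | ∀ L : Set (Formula A), IsNormalLogic L → X ⊆ L → φ ∈ L}

/-- The logic of a class of frames. -/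
def logicOf {A : Type} (C : Set (Frame A)) : Set (Formula A) :=
  {φ | ∀ F ∈ C, F.Valid φ}

/-- Finite model property: being the logic of some class of finite frames. -/
def HasFMP {A : Type} (L : Set (Formula A)) : Prop :=
  ∃ C : Set (Frame A), (∀ F ∈ C, Finite F.W) ∧ L = logicOf C

/-! ### Canonicity -/

/-- Points of the canonical frame of `L`: consistent complete theories, closed under modus
ponens, that contain `L`. -/
structure CanonPoint {A : Type} (L : Set (Formula A)) where
  carrier : Set (Formula A)
  contains : L ⊆ carrier
  mp : ∀ φ ψ, imp φ ψ ∈ carrier → φ ∈ carrier → ψ ∈ carrier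
  consistent : ∀ φ, ¬ (φ ∈ carrier ∧ neg φ ∈ carrier)
  complete : ∀ φ, φ ∈ carrier ∨ neg φ ∈ carrier

/-- The accessibility relations of the canonical frame of `L`. -/
def canonRel {A : Type} (L : Set (Formula A)) (e : A) (x y : CanonPoint L) : Prop :=
  ∀ φ, box e φ ∈ x.carrier → φ ∈ y.carrier

/-- A logic is canonical if it is valid on its canonical frame. -/
def IsCanonical {A : Type} (L : Set (Formula A)) : Prop :=
  ∀ φ ∈ L, ValidOn (canonRel L) φ

/-- A formula is canonical if the least normal logic containing it is canonical. -/
def IsCanonicalFormula {A : Type} (φ : Formula A) : Prop :=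
  IsCanonical (leastLogic {φ})

/-! ### First-order frame language and the fragment MFP -/

/-- First-order formulas with equality and with one binary relation symbol for each index in
`A`; individual variables are `ℕ`. -/
inductive FOFormula (A : Type) : Type where
  | fls : FOFormula A
  | rel : A → ℕ → ℕ → FOFormula A
  | eq : ℕ → ℕ → FOFormula A
  | and : FOFormula A → FOFormula A → FOFormula A
  | or : FOFormula A → FOFormula A → FOFormula A
  | imp : FOFormula A → FOFormula A → FOFormula A
  | all : ℕ → FOFormula A → FOFormula A
  | ex : ℕ → FOFormula A → FOFormula A

/-- First-order satisfaction in `(W, R)` under an assignment. -/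
def FOFormula.Sat {A W : Type} (R : A → W → W → Prop) : FOFormula A → (ℕ → W) → Prop
  | .fls, _ => False
  | .rel e x y, s => R e (s x) (s y)
  | .eq x y, s => s x = s y
  | .and P Q, s => Sat R P s ∧ Sat R Q s
  | .or P Q, s => Sat R P s ∨ Sat R Q s
  | .imp P Q, s => Sat R P s → Sat R Q s
  | .all v P, s => ∀ w : W, Sat R P (Function.update s v w)
  | .ex v P, s => ∃ w : W, Sat R P (Function.update s v w)

/-- The fragment MFP. -/
inductive IsMFP {A : Type} : FOFormula A → Prop where
  | rel (e : A) (x y : ℕ) : IsMFP (.rel e x y)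
  | eq (x y : ℕ) : IsMFP (.eq x y)
  | and {P Q : FOFormula A} : IsMFP P → IsMFP Q → IsMFP (.and P Q)
  | or {P Q : FOFormula A} : IsMFP P → IsMFP Q → IsMFP (.or P Q)
  | all (v : ℕ) {P : FOFormula A} : IsMFP P → IsMFP (.all v P)
  | ex (v : ℕ) {P : FOFormula A} : IsMFP P → IsMFP (.ex v P)
  | guardRel (e : A) {x y : ℕ} (hxy : x ≠ y) {P : FOFormula A} : IsMFP P →
      IsMFP (.all x (.all y (.imp (.rel e x y) P)))
  | guardEq {x y : ℕ} (hxy : x ≠ y) {P : FOFormula A} : IsMFP P →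
      IsMFP (.all x (.all y (.imp (.eq x y) P)))

/-- Modal MFP-formulas: those with a first-order equivalent on frames in MFP.  A first-order
formula is true in a frame if it holds under all assignments. -/
def IsModalMFP {A : Type} (φ : Formula A) : Prop :=
  ∃ P : FOFormula A, IsMFP P ∧
    ∀ F : Frame A, F.Valid φ ↔ ∀ s : ℕ → F.W, P.Sat F.rel s

/-! ### The logics K, T, K4, S4, S5 -/

def axT {A : Type} (e : A) : Formula A := imp (box e (var 0)) (var 0)

def ax4 {A : Type} (e : A) : Formula A := imp (box e (var 0)) (box e (box e (var 0)))

def axB {A : Type} (e : A) : Formula A := imp (var 0) (box e (dia e (var 0)))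

/-- `L` is one of the unimodal logics K, T, K4, S4, S5, where `e` is the only modality. -/
def IsBasicUnimodal {A : Type} (L : Set (Formula A)) : Prop :=
  ∃ e : A, (∀ f : A, f = e) ∧
    (L = leastLogic ∅ ∨ L = leastLogic {axT e} ∨ L = leastLogic {ax4 e} ∨
      L = leastLogic {axT e, ax4 e} ∨ L = leastLogic {axT e, ax4 e, axB e})

/-- `L` is axiomatized (over the least normal logic) by canonical modal MFP-formulas. -/
def IsCanonicalMFPLogic {A : Type} (L : Set (Formula A)) : Prop :=
  ∃ Φ : Set (Formula A), (∀ φ ∈ Φ, IsCanonicalFormula φ ∧ IsModalMFP φ) ∧ L = leastLogic Φ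

/-! ### Fusions and PDL-like expansions -/

/-- The fusion of logics over the disjoint union of their alphabets. -/
def fusion {k : ℕ} {A : Fin k → Type} (L : ∀ i, Set (Formula (A i))) :
    Set (Formula ((i : Fin k) × A i)) :=
  leastLogic (⋃ i, Formula.map (Sigma.mk i) '' L i)

/-- The alphabet `A` together with new symbols `e ∘ f`, `e ∪ f`, `e⁺` for `e, f` in `A`. -/
inductive Sharp (A : Type) : Type where
  | base : A → Sharp A
  | comp : A → A → Sharp A
  | union : A → A → Sharp A
  | plus : A → Sharp A

/-- The PDL-like axioms for the new modalities. -/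
inductive SharpAxiom {A : Type} : Formula (Sharp A) → Prop where
  | union (e c : A) : SharpAxiom
      (iff (box (.union e c) (var 0)) (and (box (.base e) (var 0)) (box (.base c) (var 0))))
  | comp (e c : A) : SharpAxiom
      (iff (box (.comp e c) (var 0)) (box (.base e) (box (.base c) (var 0))))
  | plusSub (e : A) : SharpAxiom
      (imp (box (.plus e) (var 0)) (box (.base e) (var 0)))
  | plusStep (e : A) : SharpAxiom
      (imp (box (.plus e) (var 0)) (box (.base e) (box (.plus e) (var 0))))
  | plusInd (e : A) : SharpAxiom
      (imp (box (.plus e) (imp (var 0) (box (.base e) (var 0))))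
        (imp (box (.base e) (var 0)) (box (.plus e) (var 0))))

/-- The least normal logic over `Sharp A` containing `L` and the PDL-like axioms. -/
def sharpLogic {A : Type} (L : Set (Formula A)) : Set (Formula (Sharp A)) :=
  leastLogic (Formula.map Sharp.base '' L ∪ {φ | SharpAxiom φ})

/-- The `n`-fold iterated alphabet. -/
def IterAlphabet (A : Type) : ℕ → Type
  | 0 => A
  | n + 1 => Sharp (IterAlphabet A n)

/-- The `n`-fold iterated expansion of a logic. -/
def iterLogic {A : Type} (L : Set (Formula A)) : (n : ℕ) → Set (Formula (IterAlphabet A n))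
  | 0 => L
  | n + 1 => sharpLogic (iterLogic L n)

end PDLization

namespace PDLization

open Formula

/-! ### Soundness and elementary semantics -/

section Semantics

variable {A B : Type} {W : Type}

/-! The proof filtrates a canonical model, through a property of logics strong enough to survive
every construction involved. `Filtrable L` says: given a countable general frame for `L` and
finitely many boxes to be respected, all sufficiently fine finite quotients with definable fibres
carry a filtration whose underlying frame validates `L`.

Handling all fine quotients at once gives fusions: the components can be filtrated on one common
quotient and their relations put side by side (`filtrable_fusion`). Definability of the fibres gives
the expansions: every union of fibres is definable, so the induction axiom for `e⁺` applies to the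
set of points whose class is reachable, although `R e⁺` need not be a transitive closure
(`filtrable_sharpLogic`). The property reproduces itself, so the expansion can be iterated.

For K, T, K4, S4, S5 the relation is the corresponding closure of the minimal filtration. For
canonical MFP-logics the image of `R` itself may fail: `R` validates the axioms only under definable
valuations. Instead a letter is assigned to each definable set and `R` is replaced by a part of the
canonical frame, where canonicity gives full validity; MFP-formulas then pass to its image in the
quotient (`IsMFP.sat_comp`).

Finally the property is applied to the canonical frame of the logic with its definable sets, and the
filtration lemma refutes each non-theorem on a finite frame (`hasFMP_of_filtrable`). -/

theorem sat_map (f : A → B) (R : B → W → W → Prop) (V : ℕ → W → Prop) (φ : Formula A) (x : W) :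
    Sat R V (φ.map f) x ↔ Sat (fun e => R (f e)) V φ x := by
  induction φ generalizing x with
  | bot => rfl
  | var n => rfl
  | imp φ ψ ih₁ ih₂ => exact imp_congr (ih₁ x) (ih₂ x)
  | box e φ ih => exact forall_congr' fun y => imp_congr Iff.rfl (ih y)

theorem sat_subst (R : A → W → W → Prop) (V : ℕ → W → Prop) (σ : ℕ → Formula A)
    (φ : Formula A) (x : W) :
    Sat R V (φ.subst σ) x ↔ Sat R (fun n y => Sat R V (σ n) y) φ x := by
  induction φ generalizing x with
  | bot => rfl
  | var n => rfl
  | imp φ ψ ih₁ ih₂ => exact imp_congr (ih₁ x) (ih₂ x)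
  | box e φ ih => exact forall_congr' fun y => imp_congr Iff.rfl (ih y)

theorem sat_boolEval (R : A → W → W → Prop) (V : ℕ → W → Prop) (φ : Formula A) (x : W) :
    boolEval (fun ψ => Sat R V ψ x) φ ↔ Sat R V φ x := by
  induction φ with
  | bot => rfl
  | var n => rfl
  | imp φ ψ ih₁ ih₂ => exact imp_congr ih₁ ih₂
  | box e φ ih => rfl

theorem sat_and {R : A → W → W → Prop} {V : ℕ → W → Prop} {φ ψ : Formula A} {x : W} :
    Sat R V (Formula.and φ ψ) x ↔ Sat R V φ x ∧ Sat R V ψ x := by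
  simp only [Formula.and, neg, Sat]
  tauto

theorem sat_iff {R : A → W → W → Prop} {V : ℕ → W → Prop} {φ ψ : Formula A} {x : W} :
    Sat R V (Formula.iff φ ψ) x ↔ (Sat R V φ x ↔ Sat R V ψ x) := by
  simp only [Formula.iff, sat_and, Sat]
  tauto

theorem isNormalLogic_validOn (R : A → W → W → Prop) : IsNormalLogic {φ | ValidOn R φ} where
  taut φ h V x := (sat_boolEval R V φ x).1 (h _)
  axK _ _ _ h h' y hy := h y hy (h' y hy)
  mp _ _ h h' V x := h V x (h' V x)
  substitution σ φ h V x := (sat_subst R V σ φ x).2 (h _ x)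
  nec _ _ h V _ y _ := h V y

theorem validOn_leastLogic {R : A → W → W → Prop} {X : Set (Formula A)}
    (h : ∀ φ ∈ X, ValidOn R φ) : ∀ φ ∈ leastLogic X, ValidOn R φ :=
  fun _ hφ => hφ _ (isNormalLogic_validOn R) h

theorem subset_leastLogic (X : Set (Formula A)) : X ⊆ leastLogic X :=
  fun _ hφ _ _ hX => hX hφ

theorem leastLogic_mono {X Y : Set (Formula A)} (h : X ⊆ Y) : leastLogic X ⊆ leastLogic Y :=
  fun _ hφ L hL hY => hφ L hL (h.trans hY)

theorem isNormalLogic_leastLogic (X : Set (Formula A)) : IsNormalLogic (leastLogic X) where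
  taut φ h _ hL _ := hL.taut φ h
  axK e _ hL _ := hL.axK e
  mp φ ψ h h' L hL hX := hL.mp φ ψ (h L hL hX) (h' L hL hX)
  substitution σ φ h L hL hX := hL.substitution σ φ (h L hL hX)
  nec e φ h L hL hX := hL.nec e φ (h L hL hX)

/-- Validity is preserved under passing to (embedded) generated subframes. -/
theorem validOn_of_generated {P F : Type} {R : A → P → P → Prop} {T : A → F → F → Prop}
    (f : P → F) (hf : Function.Injective f) (forth : ∀ e x y, R e x y → T e (f x) (f y))
    (back : ∀ e x z, T e (f x) z → ∃ y, f y = z ∧ R e x y) {φ : Formula A}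
    (h : ValidOn T φ) : ValidOn R φ := by
  intro V x
  -- Each letter is interpreted by the image of its truth set; truth then agrees along `f`.
  have key : ∀ (ψ : Formula A) (x : P),
      Sat T (fun n z => ∃ y, f y = z ∧ V n y) ψ (f x) ↔ Sat R V ψ x := by
    intro ψ
    induction ψ with
    | bot => exact fun _ => Iff.rfl
    | var n =>
      intro x
      constructor
      · rintro ⟨y, hy, hV⟩
        exact hf hy ▸ hV
      · exact fun hV => ⟨x, rfl, hV⟩
    | imp φ ψ ih₁ ih₂ => exact fun x => imp_congr (ih₁ x) (ih₂ x)
    | box e φ ih =>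
      intro x
      constructor
      · exact fun hx y hy => (ih y).1 (hx _ (forth e x y hy))
      · intro hx z hz
        obtain ⟨y, rfl, hy⟩ := back e x z hz
        exact (ih y).2 (hx y hy)
  exact (key φ x).1 (h _ _)

end Semantics

/-! ### General frames and uniform definable filtrations -/

/-- `D` is an algebra of subsets of the frame `(W, R)`, closed under the modal operators. -/
structure IsModalAlgebra {A W : Type} (R : A → W → W → Prop) (D : Set (Set W)) : Prop where
  empty : ∅ ∈ D
  imp : ∀ X ∈ D, ∀ Y ∈ D, {x | x ∈ X → x ∈ Y} ∈ D
  box : ∀ e, ∀ X ∈ D, {x | ∀ y, R e x y → y ∈ X} ∈ D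

namespace IsModalAlgebra

variable {A W : Type} {R : A → W → W → Prop} {D : Set (Set W)}

theorem compl (h : IsModalAlgebra R D) {X : Set W} (hX : X ∈ D) : Xᶜ ∈ D :=
  h.imp X hX ∅ h.empty

theorem union (h : IsModalAlgebra R D) {X Y : Set W} (hX : X ∈ D) (hY : Y ∈ D) :
    X ∪ Y ∈ D := by
  convert h.imp _ (h.compl hX) Y hY using 1
  ext x
  simp only [Set.mem_union, Set.mem_compl_iff, Set.mem_ofPred_eq]
  tauto

theorem biUnion (h : IsModalAlgebra R D) {ι : Type} {s : Set ι} (hs : s.Finite) {f : ι → Set W}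
    (hf : ∀ i, f i ∈ D) : (⋃ i ∈ s, f i) ∈ D := by
  induction s, hs using Set.Finite.induction_on with
  | empty => simpa using h.empty
  | insert _ _ ih =>
    rw [Set.biUnion_insert]
    exact h.union (hf _) ih

theorem biInter (h : IsModalAlgebra R D) {ι : Type} {s : Set ι} (hs : s.Finite) {f : ι → Set W}
    (hf : ∀ i, f i ∈ D) : (⋂ i ∈ s, f i) ∈ D := by
  have := h.compl (h.biUnion hs fun i => h.compl (hf i))
  simpa [Set.compl_iUnion] using this

theorem preimage (h : IsModalAlgebra R D) {Q : Type} [Finite Q] {π : W → Q}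
    (hπ : ∀ q, π ⁻¹' {q} ∈ D) (s : Set Q) : π ⁻¹' s ∈ D := by
  rw [← Set.biUnion_preimage_singleton]
  exact h.biUnion s.toFinite hπ

theorem reindex {B : Type} (h : IsModalAlgebra R D) (f : B → A) :
    IsModalAlgebra (fun e => R (f e)) D :=
  ⟨h.empty, h.imp, fun e => h.box (f e)⟩

end IsModalAlgebra

/-- Truth of all formulas in `L` in the general frame `(W, R, D)`. -/
def GeneralValid {A W : Type} (R : A → W → W → Prop) (D : Set (Set W)) (L : Set (Formula A)) :
    Prop :=
  ∀ φ ∈ L, ∀ V : ℕ → W → Prop, (∀ n, {x | V n x} ∈ D) → ∀ x, Sat R V φ x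

/-- `X` is a union of fibres of `π`. -/
def Saturated {W Q : Type} (π : W → Q) (X : Set W) : Prop :=
  ∀ x y, π x = π y → x ∈ X → y ∈ X

/-- The relations `S` filtrate the relations `R` along `π`, with respect to the pairs of a
modality and its argument in `G`. -/
structure IsFiltration {A W Q : Type} (R : A → W → W → Prop) (π : W → Q)
    (G : Set (A × Set W)) (S : A → Q → Q → Prop) : Prop where
  min : ∀ e x y, R e x y → S e (π x) (π y)
  max : ∀ p ∈ G, ∀ x y, S p.1 (π x) (π y) → (∀ z, R p.1 x z → z ∈ p.2) → y ∈ p.2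

/-- Every countable general frame for `L` has filtrations that validate `L`, along every finite
definable quotient that is fine enough. -/
def Filtrable {A : Type} (L : Set (Formula A)) : Prop :=
  ∀ (W : Type) [Nonempty W] (R : A → W → W → Prop) (D : Set (Set W)), IsModalAlgebra R D →
    D.Countable → GeneralValid R D L →
    ∀ G : Set (A × Set W), G.Finite → (∀ p ∈ G, p.2 ∈ D) →
      ∃ H : Set (Set W), H.Finite ∧ H ⊆ D ∧
        ∀ (Q : Type) [Finite Q] (π : W → Q), Function.Surjective π → (∀ q, π ⁻¹' {q} ∈ D) →
          (∀ X ∈ H, Saturated π X) →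
          ∃ S : A → Q → Q → Prop, IsFiltration R π G S ∧ ∀ φ ∈ L, ValidOn S φ

/-- A set `H` as in `Filtrable` that is sufficient for the basic logics. -/
theorem Filtrable.of_saturated {A : Type} {L : Set (Formula A)}
    (h : ∀ (W : Type) [Nonempty W] (R : A → W → W → Prop) (D : Set (Set W)),
      IsModalAlgebra R D → D.Countable → GeneralValid R D L →
      ∀ G : Set (A × Set W), (∀ p ∈ G, p.2 ∈ D) →
        ∀ (Q : Type) [Finite Q] (π : W → Q), Function.Surjective π → (∀ q, π ⁻¹' {q} ∈ D) →
          (∀ p ∈ G, Saturated π p.2 ∧ Saturated π {x | ∀ y, R p.1 x y → y ∈ p.2}) →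
          ∃ S : A → Q → Q → Prop, IsFiltration R π G S ∧ ∀ φ ∈ L, ValidOn S φ) :
    Filtrable L := by
  intro W _ R D hD hc hL G hG hGD
  refine ⟨Prod.snd '' G ∪ (fun p : A × Set W => {x | ∀ y, R p.1 x y → y ∈ p.2}) '' G,
    (hG.image _).union (hG.image _), ?_, ?_⟩
  · rintro X (⟨p, hp, rfl⟩ | ⟨p, hp, rfl⟩)
    · exact hGD p hp
    · exact hD.box _ _ (hGD p hp)
  · intro Q _ π hπ hfib hsat
    exact h W R D hD hc hL G hGD Q π hπ hfib fun p hp =>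
      ⟨hsat _ (Or.inl ⟨p, hp, rfl⟩), hsat _ (Or.inr ⟨p, hp, rfl⟩)⟩

/-! ### The logics K, T, K4, S4, S5 -/

section Basic

variable {A W Q : Type}

theorem validOn_axT {S : A → Q → Q → Prop} {e : A} (h : ∀ q, S e q q) : ValidOn S (axT e) :=
  fun _ x hx => hx x (h x)

theorem validOn_ax4 {S : A → Q → Q → Prop} {e : A}
    (h : ∀ q r s, S e q r → S e r s → S e q s) : ValidOn S (ax4 e) :=
  fun _ x hx y hy z hz => hx z (h x y z hy hz)

theorem validOn_axB {S : A → Q → Q → Prop} {e : A} (h : ∀ q r, S e q r → S e r q) :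
    ValidOn S (axB e) :=
  fun _ x hx y hy hn => hn x (h x y hy) hx

variable {R : A → W → W → Prop} {D : Set (Set W)} {L : Set (Formula A)} {e : A} {X : Set W}

theorem GeneralValid.axT (h : GeneralValid R D L) (he : PDLization.axT e ∈ L) (hX : X ∈ D) {x : W}
    (hx : ∀ y, R e x y → y ∈ X) : x ∈ X :=
  h _ he (fun _ x => x ∈ X) (fun _ => hX) x hx

theorem GeneralValid.ax4 (h : GeneralValid R D L) (he : PDLization.ax4 e ∈ L) (hX : X ∈ D) {x : W}
    (hx : ∀ y, R e x y → y ∈ X) : ∀ y, R e x y → ∀ z, R e y z → z ∈ X :=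
  h _ he (fun _ x => x ∈ X) (fun _ => hX) x hx

/-- This is the dual form of the axiom, obtained by assigning the complement of `X` to the letter.
-/
theorem GeneralValid.axB (h : GeneralValid R D L) (he : PDLization.axB e ∈ L)
    (hD : IsModalAlgebra R D) (hX : X ∈ D) {x y : W} (hxy : R e x y)
    (hy : ∀ z, R e y z → z ∈ X) : x ∈ X := by
  by_contra hx
  exact h _ he (fun _ x => x ∈ Xᶜ) (fun _ => hD.compl hX) x hx y hxy fun z hz hzX =>
    hzX (hy z hz)

/-- The minimal filtration relation. -/
def minRel (R : A → W → W → Prop) (π : W → Q) (e : A) (q r : Q) : Prop :=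
  ∃ x y, R e x y ∧ π x = q ∧ π y = r

/-- Saturation moves the boxed hypothesis from `x` to the source of a witnessing pair, and the
conclusion from its target to `y`. -/
theorem minRel_max {π : W → Q} (hX : Saturated π X)
    (hbox : Saturated π {x | ∀ y, R e x y → y ∈ X}) {x y : W} (h : minRel R π e (π x) (π y))
    (hx : ∀ z, R e x z → z ∈ X) : y ∈ X := by
  obtain ⟨x', y', hxy, hx', hy'⟩ := h
  exact hX y' y hy' (hbox x x' hx'.symm hx y' hxy)

theorem minRel_max_box {π : W → Q} (hL : GeneralValid R D L) (h4 : ax4 e ∈ L) (hXD : X ∈ D)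
    (hbox : Saturated π {x | ∀ y, R e x y → y ∈ X}) {x y : W} (h : minRel R π e (π x) (π y))
    (hx : ∀ z, R e x z → z ∈ X) : ∀ z, R e y z → z ∈ X := by
  obtain ⟨x', y', hxy, hx', hy'⟩ := h
  exact hbox y' y hy' (hL.ax4 h4 hXD (hbox x x' hx'.symm hx) y' hxy)

/-- For a witnessing pair `y' R x'`, axiom 4 puts `[e][e]X` at `x'`, and the symmetry axiom, applied
to the definable set `[e]X`, carries `[e]X` back to `y'`. -/
theorem minRel_max_box_symm {π : W → Q} (hD : IsModalAlgebra R D) (hL : GeneralValid R D L)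
    (h4 : ax4 e ∈ L) (hB : axB e ∈ L) (hXD : X ∈ D)
    (hbox : Saturated π {x | ∀ y, R e x y → y ∈ X}) {x y : W} (h : minRel R π e (π y) (π x))
    (hx : ∀ z, R e x z → z ∈ X) : ∀ z, R e y z → z ∈ X := by
  obtain ⟨y', x', hyx, hy', hx'⟩ := h
  have h₁ := hL.ax4 h4 hXD (hbox x x' hx'.symm hx)
  exact hbox y' y hy' (hL.axB hB hD (hD.box e X hXD) hyx h₁)

theorem filtrable_of_isBasicUnimodal (hL : IsBasicUnimodal L) : Filtrable L := by
  obtain ⟨e, he, hL⟩ := hL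
  refine Filtrable.of_saturated fun W _ R D hD _ hv G hGD Q _ π hπ _ hsat => ?_
  have min : ∀ f x y, R f x y → minRel R π e (π x) (π y) := fun f x y h =>
    ⟨x, y, he f ▸ h, rfl, rfl⟩
  rcases hL with rfl | rfl | rfl | rfl | rfl
  · refine ⟨fun _ => minRel R π e, ⟨min, ?_⟩, validOn_leastLogic fun _ h => h.elim⟩
    rintro ⟨f, X⟩ hp x y h hx
    obtain rfl := he f
    exact minRel_max (hsat _ hp).1 (hsat _ hp).2 h hx
  · refine ⟨fun _ => Relation.ReflGen (minRel R π e), ⟨fun f x y h => .single (min f x y h), ?_⟩,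
      validOn_leastLogic ?_⟩
    · rintro ⟨f, X⟩ hp x y h hx
      obtain rfl := he f
      rcases (Relation.reflGen_iff _ _ _).1 h with h | h
      · exact (hsat _ hp).1 x y h.symm
          (hv.axT (subset_leastLogic _ rfl) (hGD _ hp) hx)
      · exact minRel_max (hsat _ hp).1 (hsat _ hp).2 h hx
    · rintro _ rfl
      exact validOn_axT fun _ => .refl
  · refine ⟨fun _ => Relation.TransGen (minRel R π e), ⟨fun f x y h => .single (min f x y h), ?_⟩,
      validOn_leastLogic ?_⟩
    · rintro ⟨f, X⟩ hp x y h hx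
      obtain rfl := he f
      -- Without reflexivity `[e]X` does not give `X`, so both are carried along the path: `X` is
      -- the goal, `[e]X` feeds the next step. Ranging over all representatives of a class lets each
      -- step choose its own.
      have key : ∀ r, Relation.TransGen (minRel R π f) (π x) r → ∀ y, π y = r →
          y ∈ X ∧ ∀ z, R f y z → z ∈ X := by
        intro r hr
        induction hr with
        | single h =>
          rintro y rfl
          exact ⟨minRel_max (hsat _ hp).1 (hsat _ hp).2 h hx,
            minRel_max_box hv (subset_leastLogic _ rfl) (hGD _ hp) (hsat _ hp).2 h hx⟩
        | @tail q r _ h ih =>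
          rintro y rfl
          obtain ⟨x', rfl⟩ := hπ q
          have hx' := (ih x' rfl).2
          exact ⟨minRel_max (hsat _ hp).1 (hsat _ hp).2 h hx',
            minRel_max_box hv (subset_leastLogic _ rfl) (hGD _ hp) (hsat _ hp).2 h hx'⟩
      exact (key _ h y rfl).1
    · rintro _ rfl
      exact validOn_ax4 fun _ _ _ => Relation.TransGen.trans
  · have hT : axT e ∈ leastLogic {axT e, ax4 e} := subset_leastLogic _ (by simp)
    have h4 : ax4 e ∈ leastLogic {axT e, ax4 e} := subset_leastLogic _ (by simp)
    refine ⟨fun _ => Relation.ReflTransGen (minRel R π e),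
      ⟨fun f x y h => .single (min f x y h), ?_⟩, validOn_leastLogic ?_⟩
    · rintro ⟨f, X⟩ hp x y h hx
      obtain rfl := he f
      -- Here `[e]X` alone suffices, since axiom T recovers `X` at the end.
      have key : ∀ r, Relation.ReflTransGen (minRel R π f) (π x) r → ∀ y, π y = r →
          ∀ z, R f y z → z ∈ X := by
        intro r hr
        induction hr with
        | refl => exact fun y hy => (hsat _ hp).2 x y hy.symm hx
        | @tail q r _ h ih =>
          rintro y rfl
          obtain ⟨x', rfl⟩ := hπ q
          exact minRel_max_box hv h4 (hGD _ hp) (hsat _ hp).2 h (ih x' rfl)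
      exact hv.axT hT (hGD _ hp) (key _ h y rfl)
    · rintro _ (rfl | rfl)
      · exact validOn_axT fun _ => .refl
      · exact validOn_ax4 fun _ _ _ => Relation.ReflTransGen.trans
  · have hT : axT e ∈ leastLogic {axT e, ax4 e, axB e} := subset_leastLogic _ (by simp)
    have h4 : ax4 e ∈ leastLogic {axT e, ax4 e, axB e} := subset_leastLogic _ (by simp)
    have hB : axB e ∈ leastLogic {axT e, ax4 e, axB e} := subset_leastLogic _ (by simp)
    refine ⟨fun _ => Relation.EqvGen (minRel R π e),
      ⟨fun f x y h => .rel _ _ (min f x y h), ?_⟩, validOn_leastLogic ?_⟩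
    · rintro ⟨f, X⟩ hp x y h hx
      obtain rfl := he f
      -- In S5 the truth value of `[e]X` is constant along the generated equivalence.
      have key : ∀ q r, Relation.EqvGen (minRel R π f) q r → ∀ x y, π x = q → π y = r →
          ((∀ z, R f x z → z ∈ X) ↔ ∀ z, R f y z → z ∈ X) := by
        intro q r hr
        induction hr with
        | rel q r h =>
          rintro x y rfl rfl
          exact ⟨minRel_max_box hv h4 (hGD _ hp) (hsat _ hp).2 h,
            minRel_max_box_symm hD hv h4 hB (hGD _ hp) (hsat _ hp).2 h⟩
        | refl q =>
          rintro x y rfl hy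
          exact ⟨(hsat _ hp).2 x y hy.symm, (hsat _ hp).2 y x hy⟩
        | symm q r _ ih => exact fun x y hx hy => (ih y x hy hx).symm
        | trans q r s _ _ ih₁ ih₂ =>
          intro x y hx hy
          obtain ⟨z, hz⟩ := hπ r
          exact (ih₁ x z hx hz).trans (ih₂ z y hz hy)
      exact hv.axT hT (hGD _ hp) ((key _ _ h x y rfl rfl).1 hx)
    · rintro _ (rfl | rfl | rfl)
      · exact validOn_axT fun q => .refl q
      · exact validOn_ax4 fun q r s => .trans q r s
      · exact validOn_axB fun q r => .symm q r

end Basic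

/-! ### Canonical MFP-logics -/

/-- MFP-formulas are preserved under surjective homomorphisms that lift all related pairs. -/
theorem IsMFP.sat_comp {A P Q : Type} {R : A → P → P → Prop} {ρ : P → Q}
    (hρ : Function.Surjective ρ) {B : FOFormula A} (hB : IsMFP B) (s : ℕ → P)
    (h : B.Sat R s) : B.Sat (minRel R ρ) (ρ ∘ s) := by
  have upd : ∀ (s : ℕ → P) v w, ρ ∘ Function.update s v w = Function.update (ρ ∘ s) v (ρ w) :=
    fun s v w => Function.comp_update ρ s v w
  induction hB generalizing s with
  | rel e x y => exact ⟨_, _, h, rfl, rfl⟩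
  | eq x y => exact congrArg ρ h
  | and _ _ ih₁ ih₂ => exact ⟨ih₁ s h.1, ih₂ s h.2⟩
  | or _ _ ih₁ ih₂ => exact h.imp (ih₁ s) (ih₂ s)
  | all v _ ih =>
    intro q
    obtain ⟨w, rfl⟩ := hρ q
    exact upd s v w ▸ ih _ (h w)
  | ex v _ ih =>
    obtain ⟨w, hw⟩ := h
    exact ⟨ρ w, upd s v w ▸ ih _ hw⟩
  | @guardRel e x y hxy P _ ih =>
    -- The guard holds in the image only because of some related pair upstairs, and the hypothesis
    -- is applied to that pair.
    rintro q r ⟨a, b, hab, ha, hb⟩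
    simp only [Function.update_self, Function.update_of_ne hxy] at ha hb
    subst ha hb
    rw [← upd, ← upd]
    refine ih _ (h a b ?_)
    simpa [FOFormula.Sat, Function.update_of_ne hxy] using hab
  | @guardEq x y hxy P _ ih =>
    intro q r hqr
    simp only [FOFormula.Sat, Function.update_self, Function.update_of_ne hxy] at hqr
    subst hqr
    obtain ⟨a, rfl⟩ := hρ q
    rw [← upd, ← upd]
    refine ih _ (h a a ?_)
    simp [FOFormula.Sat, Function.update_of_ne hxy]

section CanonicalSubframe

variable {A W : Type} {L : Set (Formula A)} {R : A → W → W → Prop} {V : ℕ → W → Prop}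

/-- The theory of a point in a model of `L`. -/
def pointTheory (hV : ∀ φ ∈ L, ∀ x, Sat R V φ x) (x : W) : CanonPoint L where
  carrier := {φ | Sat R V φ x}
  contains φ hφ := hV φ hφ x
  mp _ _ h h' := h h'
  consistent _ h := h.2 h.1
  complete φ := Classical.em (Sat R V φ x)

/-- The part of the canonical frame of `L` where everything true throughout `(W, R, V)` holds. -/
def TheoryPoint (L : Set (Formula A)) (R : A → W → W → Prop) (V : ℕ → W → Prop) : Type :=
  {y : CanonPoint L // ∀ φ, (∀ x, Sat R V φ x) → φ ∈ y.carrier}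

def theoryRel (e : A) (y z : TheoryPoint L R V) : Prop := canonRel L e y.1 z.1

theorem CanonPoint.ext_carrier {y z : CanonPoint L} (h : y.carrier = z.carrier) : y = z := by
  cases y
  cases z
  congr

/-- If a formula is true throughout the model, so is its box. Hence the points containing all such
formulas are closed under successors in the canonical frame of the logic of `φ` alone, and form a
generated subframe there. Each axiom is treated separately, so canonicity of `L` as a whole is not
needed. -/
theorem validOn_theoryRel (hV : ∀ φ ∈ L, ∀ x, Sat R V φ x) {φ : Formula A} (hφL : leastLogic {φ} ⊆ L) (hφ : IsCanonicalFormula φ) :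
    ValidOn (theoryRel (L := L) (R := R) (V := V)) φ := by
  let f : TheoryPoint L R V → CanonPoint (leastLogic {φ}) := fun y =>
    ⟨y.1.carrier, hφL.trans y.1.contains, y.1.mp, y.1.consistent, y.1.complete⟩
  refine validOn_of_generated f ?_ (fun e x y h => h) ?_ (hφ φ (subset_leastLogic _ rfl))
  · intro y z h
    exact Subtype.ext (CanonPoint.ext_carrier (show (f y).carrier = (f z).carrier by rw [h]))
  · intro e x z h
    have hz : ∀ φ, (∀ x, Sat R V φ x) → φ ∈ z.carrier := fun φ hφ =>
      h _ (x.2 (box e φ) fun _ y _ => hφ y)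
    have hLz : L ⊆ z.carrier := fun φ hφ => hz φ (hV φ hφ)
    exact ⟨⟨⟨z.carrier, hLz, z.mp, z.consistent, z.complete⟩, hz⟩, rfl, h⟩


theorem TheoryPoint.mono (y : TheoryPoint L R V) {φ ψ : Formula A}
    (h : ∀ x, Sat R V φ x → Sat R V ψ x) (hφ : φ ∈ y.1.carrier) : ψ ∈ y.1.carrier :=
  y.1.mp φ ψ (y.2 (imp φ ψ) h) hφ

theorem TheoryPoint.not_disjoint (y : TheoryPoint L R V) {φ ψ : Formula A}
    (hφ : φ ∈ y.1.carrier) (hψ : ψ ∈ y.1.carrier) : ∃ x, Sat R V φ x ∧ Sat R V ψ x := by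
  by_contra h
  push Not at h
  exact y.1.consistent ψ ⟨hψ, y.mono (ψ := neg ψ) h hφ⟩

end CanonicalSubframe

/-- Each fibre of `π` is named by a letter, and every point of the theory frame contains exactly one
fibre name. This defines a map `ρ` onto `Q` that extends `π`; the filtration is the image under `ρ`
of the theory frame's relations. -/
theorem filtrable_of_isCanonicalMFPLogic {A : Type} {L : Set (Formula A)}
    (hL : IsCanonicalMFPLogic L) : Filtrable L := by
  obtain ⟨Φ, hΦ, rfl⟩ := hL
  refine Filtrable.of_saturated fun W _ R D hD hc hv G hGD Q _ π hπ hfib hsat => ?_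
  -- Countability of the algebra lets the letters name all definable sets.
  obtain ⟨U, rfl⟩ := hc.exists_eq_range ⟨∅, hD.empty⟩
  let V : ℕ → W → Prop := fun n x => x ∈ U n
  have hV : ∀ φ ∈ leastLogic Φ, ∀ x, Sat R V φ x := fun φ hφ => hv φ hφ V fun n => ⟨n, rfl⟩
  choose l hl using hfib
  have hl' : ∀ q x, Sat R V (var (l q)) x ↔ π x = q := by
    intro q x
    change x ∈ U (l q) ↔ _
    rw [hl]
    rfl
  have exists_mem : ∀ y : TheoryPoint (leastLogic Φ) R V, ∃ q, var (l q) ∈ y.1.carrier := by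
    intro y
    by_contra h
    push Not at h
    -- If no fibre name belonged to `y`, excluding the classes one at a time would leave in `y` a
    -- name of the empty set.
    have key : ∀ s : Set Q, ∃ m, U m = π ⁻¹' sᶜ ∧ var m ∈ y.1.carrier := by
      intro s
      induction s, s.toFinite using Set.Finite.induction_on with
      | empty =>
        obtain ⟨m, hm⟩ := hD.preimage (fun q => ⟨l q, hl q⟩) (∅ᶜ : Set Q)
        refine ⟨m, hm, y.2 _ fun x => ?_⟩
        change x ∈ U m
        simp [hm]
      | @insert q s _ _ ih =>
        obtain ⟨m, hm, hmy⟩ := ih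
        obtain ⟨m', hm'⟩ := hD.preimage (fun q => ⟨l q, hl q⟩) (insert q s : Set Q)ᶜ
        refine ⟨m', hm', y.1.mp (neg (var (l q))) _ (y.mono (fun x hx hn => ?_) hmy)
          ((y.1.complete _).resolve_left (h q))⟩
        change x ∈ U m at hx
        change x ∈ U m'
        rw [hm] at hx
        rw [hm']
        have hn' : π x ≠ q := fun hq => hn ((hl' q x).2 hq)
        rintro (hq | hs)
        · exact hn' hq
        · exact hx hs
    obtain ⟨m, hm, hmy⟩ := key Set.univ
    obtain ⟨x, hx, _⟩ := y.not_disjoint hmy hmy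
    change x ∈ U m at hx
    simp [hm] at hx
  choose ρ hρ using exists_mem
  have hρ_eq : ∀ y q, var (l q) ∈ y.1.carrier → ρ y = q := by
    intro y q hq
    obtain ⟨x, hx, hx'⟩ := y.not_disjoint (hρ y) hq
    exact ((hl' _ x).1 hx).symm.trans ((hl' _ x).1 hx')
  let pt : W → TheoryPoint (leastLogic Φ) R V := fun x => ⟨pointTheory hV x, fun φ h => h x⟩
  have hpt : ∀ x, ρ (pt x) = π x := fun x => hρ_eq (pt x) (π x) ((hl' _ x).2 rfl)
  have hρ_surj : Function.Surjective ρ := fun q => by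
    obtain ⟨x, rfl⟩ := hπ q
    exact ⟨pt x, hpt x⟩
  refine ⟨minRel theoryRel ρ, ⟨fun e x y h => ⟨pt x, pt y, fun φ hφ => hφ y h, hpt x, hpt y⟩, ?_⟩,
    validOn_leastLogic fun φ hφ => ?_⟩
  · rintro ⟨e, X⟩ hp x x' ⟨y, y', hyy', hy, hy'⟩ hx
    obtain ⟨j, rfl⟩ := hGD _ hp
    -- By saturation the name of the class of `x` implies `[e]X` throughout the model, so `y`
    -- contains this box. Its successor `y'` then contains both the name of `X` and the name of the
    -- class of `x'`, so that class meets `X`.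
    have hbox : box e (var j) ∈ y.1.carrier :=
      y.mono (fun z hz => (hsat _ hp).2 x z (hy.symm.trans ((hl' _ z).1 hz).symm) hx) (hρ y)
    obtain ⟨z, hz, hzj⟩ := y'.not_disjoint (hρ y') (hyy' _ hbox)
    exact (hsat _ hp).1 z x' (((hl' _ z).1 hz).trans hy') hzj
  · obtain ⟨hcan, B, hB, hcorr⟩ := hΦ φ hφ
    obtain ⟨x₀⟩ := ‹Nonempty W›
    have hP := (hcorr ⟨TheoryPoint (leastLogic Φ) R V, ⟨pt x₀⟩, theoryRel⟩).1
      (validOn_theoryRel hV (leastLogic_mono (Set.singleton_subset_iff.2 hφ)) hcan)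
    refine (hcorr ⟨Q, ⟨π x₀⟩, minRel theoryRel ρ⟩).2 fun s => ?_
    -- An assignment into `Q` is lifted to the theory frame along a section of `ρ`.
    have := hB.sat_comp hρ_surj (Function.surjInv hρ_surj ∘ s) (hP _)
    rwa [← Function.comp_assoc, (Function.rightInverse_surjInv hρ_surj).comp_eq_id,
      Function.id_comp] at this

/-! ### Fusions and PDL-like expansions -/

/-- The requirements `H i` are finite and only ask for a fine quotient, so their union serves all
components simultaneously. -/
theorem filtrable_fusion {k : ℕ} {A : Fin k → Type} {L : ∀ i, Set (Formula (A i))}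
    (hL : ∀ i, Filtrable (L i)) : Filtrable (fusion L) := by
  intro W _ R D hD hc hv G hG hGD
  have hsub : ∀ i, ∀ φ ∈ L i, φ.map (Sigma.mk i) ∈ fusion L := fun i φ hφ =>
    subset_leastLogic _ (Set.mem_iUnion.2 ⟨i, φ, hφ, rfl⟩)
  have hinj : ∀ i, Function.Injective (Prod.map (Sigma.mk i) id : A i × Set W → _) := fun i =>
    sigma_mk_injective.prodMap Function.injective_id
  have hi := fun i => hL i W (fun e => R ⟨i, e⟩) D (hD.reindex _) hc
    (fun φ hφ V hV x => (sat_map _ R V φ x).1 (hv _ (hsub i φ hφ) V hV x))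
    (Prod.map (Sigma.mk i) id ⁻¹' G) (hG.preimage (hinj i).injOn) (fun p hp => hGD _ hp)
  choose H hfin hHD hH using hi
  refine ⟨⋃ i, H i, Set.finite_iUnion hfin, Set.iUnion_subset hHD, ?_⟩
  intro Q _ π hπ hfib hsat
  choose S hS hSv using fun i => hH i Q π hπ hfib fun X hX => hsat X (Set.mem_iUnion.2 ⟨i, hX⟩)
  refine ⟨fun e => S e.1 e.2, ⟨fun e => (hS e.1).min e.2, ?_⟩, validOn_leastLogic ?_⟩
  · rintro ⟨⟨i, e⟩, X⟩ hp
    exact (hS i).max (e, X) hp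
  · intro ψ hψ
    obtain ⟨i, φ, hφ, rfl⟩ := Set.mem_iUnion.1 hψ
    exact fun V x => (sat_map _ _ V φ x).2 (hSv i φ hφ V x)

/-- The standard interpretation of the new modalities. -/
def sharpRel {A Q : Type} (S : A → Q → Q → Prop) : Sharp A → Q → Q → Prop
  | .base e => S e
  | .comp e c => fun q r => ∃ s, S e q s ∧ S c s r
  | .union e c => fun q r => S e q r ∨ S c q r
  | .plus e => Relation.TransGen (S e)

theorem validOn_sharpRel {A Q : Type} (S : A → Q → Q → Prop) {φ : Formula (Sharp A)}
    (h : SharpAxiom φ) : ValidOn (sharpRel S) φ := by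
  intro V x
  cases h with
  | union e c =>
    exact sat_iff.2 ⟨fun h => sat_and.2 ⟨fun y hy => h y (.inl hy), fun y hy => h y (.inr hy)⟩,
      fun h y hy => hy.elim ((sat_and.1 h).1 y) ((sat_and.1 h).2 y)⟩
  | comp e c =>
    exact sat_iff.2 ⟨fun h y hy z hz => h z ⟨y, hy, hz⟩, fun h z ⟨y, hy, hz⟩ => h y hy z hz⟩
  | plusSub e => exact fun h y hy => h y (.single hy)
  | plusStep e => exact fun h y hy z hz => h z (.head hy hz)
  | plusInd e =>
    intro h₁ h₂ y hy
    induction hy with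
    | single hy => exact h₂ _ hy
    | tail hy hz ih => exact h₁ _ hy ih _ hz

section SharpGeneral

variable {A W : Type} {R : Sharp A → W → W → Prop} {D : Set (Set W)}
  {L : Set (Formula (Sharp A))} {X : Set W}

theorem GeneralValid.union (h : GeneralValid R D L) (hax : ∀ φ, SharpAxiom φ → φ ∈ L)
    (hX : X ∈ D) (e c : A) (x : W) :
    (∀ y, R (.union e c) x y → y ∈ X) ↔
      (∀ y, R (.base e) x y → y ∈ X) ∧ ∀ y, R (.base c) x y → y ∈ X :=
  (sat_iff.1 (h _ (hax _ (.union e c)) (fun _ x => x ∈ X) (fun _ => hX) x)).trans sat_and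

theorem GeneralValid.comp (h : GeneralValid R D L) (hax : ∀ φ, SharpAxiom φ → φ ∈ L)
    (hX : X ∈ D) (e c : A) (x : W) :
    (∀ y, R (.comp e c) x y → y ∈ X) ↔
      ∀ y, R (.base e) x y → ∀ z, R (.base c) y z → z ∈ X :=
  sat_iff.1 (h _ (hax _ (.comp e c)) (fun _ x => x ∈ X) (fun _ => hX) x)

theorem GeneralValid.plusSub (h : GeneralValid R D L) (hax : ∀ φ, SharpAxiom φ → φ ∈ L)
    (hX : X ∈ D) {e : A} {x : W} (hx : ∀ y, R (.plus e) x y → y ∈ X) :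
    ∀ y, R (.base e) x y → y ∈ X :=
  h _ (hax _ (.plusSub e)) (fun _ x => x ∈ X) (fun _ => hX) x hx

theorem GeneralValid.plusStep (h : GeneralValid R D L) (hax : ∀ φ, SharpAxiom φ → φ ∈ L)
    (hX : X ∈ D) {e : A} {x : W} (hx : ∀ y, R (.plus e) x y → y ∈ X) :
    ∀ y, R (.base e) x y → ∀ z, R (.plus e) y z → z ∈ X :=
  h _ (hax _ (.plusStep e)) (fun _ x => x ∈ X) (fun _ => hX) x hx

theorem GeneralValid.plusInd (h : GeneralValid R D L) (hax : ∀ φ, SharpAxiom φ → φ ∈ L)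
    (hX : X ∈ D) {e : A} {x : W} (hx : ∀ y, R (.base e) x y → y ∈ X)
    (hstep : ∀ x ∈ X, ∀ y, R (.base e) x y → y ∈ X) : ∀ y, R (.plus e) x y → y ∈ X :=
  h _ (hax _ (.plusInd e)) (fun _ x => x ∈ X) (fun _ => hX) x (fun y _ => hstep y) hx

end SharpGeneral

theorem filtrable_sharpLogic {A : Type} {L : Set (Formula A)} (hL : Filtrable L) :
    Filtrable (sharpLogic L) := by
  intro W _ R D hD hc hv G hG hGD
  have hsub : ∀ φ ∈ L, φ.map Sharp.base ∈ sharpLogic L := fun φ hφ =>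
    subset_leastLogic _ (Or.inl ⟨φ, hφ, rfl⟩)
  have hax : ∀ φ, SharpAxiom φ → φ ∈ sharpLogic L := fun φ hφ => subset_leastLogic _ (Or.inr hφ)
  let bx : Sharp A → Set W → Set W := fun e X => {x | ∀ y, R e x y → y ∈ X}
  -- A Fischer–Ladner style closure: the boxes that the base filtration must respect so that the
  -- standard interpretation of the new modality respects `[p.1]p.2`.
  let cl : Sharp A × Set W → Set (A × Set W) := fun p =>
    match p with
    | (.base e, X) => {(e, X)}
    | (.union e c, X) => {(e, X), (c, X)}
    | (.comp e c, X) => {(e, bx (.base c) X), (c, X)}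
    | (.plus e, X) => {(e, X), (e, bx (.plus e) X)}
  have hclD : ∀ p, p.2 ∈ D → ∀ p' ∈ cl p, p'.2 ∈ D := by
    rintro ⟨e | ⟨e, c⟩ | ⟨e, c⟩ | e, X⟩ hX p' hp'
    · obtain rfl := hp'
      exact hX
    · rcases hp' with rfl | rfl
      exacts [hD.box _ _ hX, hX]
    · rcases hp' with rfl | rfl <;> exact hX
    · rcases hp' with rfl | rfl
      exacts [hX, hD.box _ _ hX]
  have hclfin : ∀ p, (cl p).Finite := by
    rintro ⟨e | ⟨e, c⟩ | ⟨e, c⟩ | e, X⟩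
    · exact Set.finite_singleton _
    all_goals exact (Set.finite_singleton _).insert _
  obtain ⟨H, hfin, hHD, hH⟩ := hL W (fun e => R (.base e)) D (hD.reindex _) hc
    (fun φ hφ V hV x => (sat_map _ R V φ x).1 (hv _ (hsub φ hφ) V hV x))
    (⋃ p ∈ G, cl p) (hG.biUnion fun p _ => hclfin p) (fun p' hp' => by
      obtain ⟨p, hp, hp'⟩ := Set.mem_iUnion₂.1 hp'
      exact hclD p (hGD p hp) p' hp')
  refine ⟨H, hfin, hHD, fun Q _ π hπ hfib hsat => ?_⟩
  obtain ⟨S, hS, hSv⟩ := hH Q π hπ hfib hsat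
  refine ⟨sharpRel S, ⟨?_, ?_⟩, validOn_leastLogic ?_⟩
  · intro e x y hxy
    -- The set of points whose class is related to that of `x` under the standard interpretation is
    -- a union of fibres, hence definable. The axioms, applied to this set, show that it contains
    -- all `R`-successors of `x`.
    have hpre := hD.preimage hfib
    cases e with
    | base e => exact hS.min e x y hxy
    | comp e c =>
      exact (hv.comp hax (hpre {q | sharpRel S (.comp e c) (π x) q}) e c x).2
        (fun y hy z hz => ⟨π y, hS.min e x y hy, hS.min c y z hz⟩) y hxy
    | union e c =>
      exact (hv.union hax (hpre {q | sharpRel S (.union e c) (π x) q}) e c x).2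
        ⟨fun y hy => .inl (hS.min e x y hy), fun y hy => .inr (hS.min c x y hy)⟩ y hxy
    | plus e =>
      exact hv.plusInd hax (hpre {q | sharpRel S (.plus e) (π x) q})
        (fun y hy => .single (hS.min e x y hy))
        (fun y hy z hz => Relation.TransGen.tail hy (hS.min e y z hz)) y hxy
  · intro p hp x y
    have hmem : ∀ p' ∈ cl p, p' ∈ ⋃ p ∈ G, cl p := fun p' hp' => Set.mem_biUnion hp hp'
    have hX := hGD p hp
    obtain ⟨e | ⟨e, c⟩ | ⟨e, c⟩ | e, X⟩ := p
    · exact hS.max (e, X) (hmem _ rfl) x y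
    · rintro ⟨q, hq, hq'⟩ hx
      obtain ⟨z, rfl⟩ := hπ q
      have hz := hS.max (e, bx (.base c) X) (hmem _ (.inl rfl)) x z hq
        ((hv.comp hax hX e c x).1 hx)
      exact hS.max (c, X) (hmem _ (.inr rfl)) z y hq' hz
    · intro h hx
      have hx' := (hv.union hax hX e c x).1 hx
      exact h.elim (fun h => hS.max (e, X) (hmem _ (.inl rfl)) x y h hx'.1)
        fun h => hS.max (c, X) (hmem _ (.inr rfl)) x y h hx'.2
    · intro h hx
      have step : ∀ x y, S e (π x) (π y) → x ∈ bx (.plus e) X → y ∈ X ∧ y ∈ bx (.plus e) X :=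
        fun x y h hx => ⟨hS.max (e, X) (hmem _ (.inl rfl)) x y h (hv.plusSub hax hX hx),
          hS.max (e, bx (.plus e) X) (hmem _ (.inr rfl)) x y h (hv.plusStep hax hX hx)⟩
      -- As for K4, `X` is reached and `[e⁺]X` persists along the path, now by the axioms for `e⁺`.
      have key : ∀ r, Relation.TransGen (S e) (π x) r → ∀ y, π y = r →
          y ∈ X ∧ y ∈ bx (.plus e) X := by
        intro r hr
        induction hr with
        | single h =>
          rintro y rfl
          exact step x y h hx
        | @tail q r _ h ih =>
          rintro y rfl
          obtain ⟨z, rfl⟩ := hπ q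
          exact step z y h (ih z rfl).2
      exact (key _ h y rfl).1
  · rintro _ (⟨φ, hφ, rfl⟩ | hφ)
    · exact fun V x => (sat_map _ _ V φ x).2 (hSv φ hφ V x)
    · exact validOn_sharpRel S hφ

/-! ### The canonical model -/

section CanonicalModel

variable {A : Type} {L : Set (Formula A)}

/-- A version of Lindenbaum's lemma. -/
theorem exists_canonPoint (hL : IsNormalLogic L) {T : Set (Formula A)} (hLT : L ⊆ T)
    (hT : ∀ φ ψ, imp φ ψ ∈ T → φ ∈ T → ψ ∈ T) {φ : Formula A} (hφ : φ ∉ T) :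
    ∃ y : CanonPoint L, T ⊆ y.carrier ∧ φ ∉ y.carrier := by
  let Z : Set (Set (Formula A)) :=
    {U | L ⊆ U ∧ (∀ φ ψ, imp φ ψ ∈ U → φ ∈ U → ψ ∈ U) ∧ φ ∉ U}
  obtain ⟨M, hTM, hM⟩ := zorn_subset_nonempty Z (fun c hc hchain hne => by
    obtain ⟨U₀, hU₀⟩ := hne
    refine ⟨⋃₀ c, ⟨(hc hU₀).1.trans (Set.subset_sUnion_of_mem hU₀), ?_, ?_⟩,
      fun U hU => Set.subset_sUnion_of_mem hU⟩
    · rintro α β ⟨U, hU, hαβ⟩ ⟨U', hU', hα⟩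
      rcases hchain.total hU hU' with h | h
      · exact ⟨U', hU', (hc hU').2.1 α β (h hαβ) hα⟩
      · exact ⟨U, hU, (hc hU).2.1 α β hαβ (h hα)⟩
    · rintro ⟨U, hU, hφU⟩
      exact (hc hU).2.2 hφU) T ⟨hLT, hT, hφ⟩
  obtain ⟨hLM, hmp, hφM⟩ := hM.prop
  have taut : ∀ ψ, IsTautology ψ → ψ ∈ M := fun ψ h => hLM (hL.taut ψ h)
  -- Otherwise the formulas `χ` with `ψ → χ` in `M` would form a theory omitting `φ` that contains
  -- `M` and also `ψ`, against maximality.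
  have ext : ∀ ψ, ψ ∉ M → imp ψ φ ∈ M := by
    intro ψ hψ
    by_contra hn
    have hle : M ⊆ {χ | imp ψ χ ∈ M} := fun χ hχ =>
      hmp χ _ (taut (imp χ (imp ψ χ)) fun v h _ => h) hχ
    have hmem : {χ | imp ψ χ ∈ M} ∈ Z := by
      refine ⟨hLM.trans hle, fun α β hαβ hα => ?_, hn⟩
      exact hmp _ _ (hmp _ _ (taut (imp (imp ψ (imp α β)) (imp (imp ψ α) (imp ψ β)))
        fun v h₁ h₂ h₃ => h₁ h₃ (h₂ h₃)) hαβ) hα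
    exact hψ (hM.le_of_ge hmem hle (taut (imp ψ ψ) fun v h => h))
  refine ⟨⟨M, hLM, hmp, ?_, ?_⟩, hTM, hφM⟩
  · rintro ψ ⟨h, hn⟩
    exact hφM (hmp _ _ (taut (imp bot φ) fun v h => h.elim) (hmp _ _ hn h))
  · intro ψ
    by_contra h
    push Not at h
    refine hφM (hmp _ _ (hmp _ _ (taut (imp (imp ψ φ) (imp (imp (neg ψ) φ) φ))
      fun v h₁ h₂ => ?_) (ext _ h.1)) (ext _ h.2))
    by_cases hψ : boolEval v ψ
    exacts [h₁ hψ, h₂ hψ]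

theorem CanonPoint.imp_mem (hL : IsNormalLogic L) (x : CanonPoint L) (φ ψ : Formula A) :
    imp φ ψ ∈ x.carrier ↔ (φ ∈ x.carrier → ψ ∈ x.carrier) := by
  have taut : ∀ ψ, IsTautology ψ → ψ ∈ x.carrier := fun ψ h => x.contains (hL.taut ψ h)
  refine ⟨x.mp φ ψ, fun h => ?_⟩
  rcases x.complete φ with hφ | hφ
  · exact x.mp _ _ (taut (imp ψ (imp φ ψ)) fun v h _ => h) (h hφ)
  · exact x.mp _ _ (taut (imp (neg φ) (imp φ ψ)) fun v h h' => (h h').elim) hφ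

theorem CanonPoint.bot_notMem (hL : IsNormalLogic L) (x : CanonPoint L) : bot ∉ x.carrier :=
  fun h => x.consistent bot ⟨h, x.contains (hL.taut _ fun _ h => h)⟩

theorem CanonPoint.box_mem (hL : IsNormalLogic L) (x : CanonPoint L) (e : A) (φ : Formula A) :
    box e φ ∈ x.carrier ↔ ∀ y, canonRel L e x y → φ ∈ y.carrier := by
  refine ⟨fun h y hy => hy φ h, fun h => ?_⟩
  by_contra hφ
  -- The formulas boxed in `x` contain `L` by necessitation and are closed under modus ponens by
  -- axiom K.
  obtain ⟨y, hy, hφy⟩ := exists_canonPoint hL (T := {χ | box e χ ∈ x.carrier})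
    (fun χ hχ => x.contains (hL.nec e χ hχ))
    (fun α β hαβ hα => x.mp _ _ (x.mp _ _ (x.contains
      (hL.substitution (fun n => if n = 0 then α else β) _ (hL.axK e))) hαβ) hα) hφ
  exact hφy (h y hy)

/-- The truth lemma for arbitrary definable valuations. -/
theorem sat_canonRel (hL : IsNormalLogic L) (σ : ℕ → Formula A) (φ : Formula A)
    (x : CanonPoint L) :
    Sat (canonRel L) (fun n y => σ n ∈ y.carrier) φ x ↔ φ.subst σ ∈ x.carrier := by
  induction φ generalizing x with
  | bot => exact (iff_false_intro (x.bot_notMem hL)).symm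
  | var n => rfl
  | imp φ ψ ih₁ ih₂ => exact (imp_congr (ih₁ x) (ih₂ x)).trans (x.imp_mem hL _ _).symm
  | box e φ ih =>
    exact (forall_congr' fun y => imp_congr Iff.rfl (ih y)).trans (x.box_mem hL _ _).symm

/-- The definable subsets of the canonical frame. -/
def canonAlgebra (L : Set (Formula A)) : Set (Set (CanonPoint L)) :=
  Set.range fun φ => {x | φ ∈ x.carrier}

theorem isModalAlgebra_canonAlgebra (hL : IsNormalLogic L) :
    IsModalAlgebra (canonRel L) (canonAlgebra L) where
  empty := ⟨bot, Set.eq_empty_of_forall_notMem fun x => x.bot_notMem hL⟩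
  imp := by
    rintro _ ⟨φ, rfl⟩ _ ⟨ψ, rfl⟩
    exact ⟨imp φ ψ, Set.ext fun x => x.imp_mem hL φ ψ⟩
  box := by
    rintro e _ ⟨φ, rfl⟩
    exact ⟨box e φ, Set.ext fun x => x.box_mem hL e φ⟩

/-- A definable valuation is a substitution, under which `L` is closed. -/
theorem generalValid_canonAlgebra (hL : IsNormalLogic L) :
    GeneralValid (canonRel L) (canonAlgebra L) L := by
  intro φ hφ V hV x
  choose σ hσ using hV
  obtain rfl : (fun n y => σ n ∈ y.carrier) = V :=
    funext fun n => funext fun y => propext (Set.ext_iff.1 (hσ n) y)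
  exact (sat_canonRel hL σ φ x).2 (x.contains (hL.substitution σ φ hφ))

end CanonicalModel

/-! ### Countability -/

theorem countable_formula (A : Type) [Countable A] : Countable (Formula A) := by
  -- Stage `n` contains the formulas of nesting depth at most `n`.
  let N : ℕ → Set (Formula A) := fun n => n.rec ({bot} ∪ Set.range var)
    fun _ X => X ∪ (Set.image2 imp X X ∪ Set.image2 box Set.univ X)
  have hN : ∀ n, (N n).Countable := by
    intro n
    induction n with
    | zero => exact (Set.countable_singleton _).union (Set.countable_range _)
    | succ n ih => exact ih.union ((ih.image2 ih _).union (Set.countable_univ.image2 ih _))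
  have hmono : Monotone N := monotone_nat_of_le_succ fun n => Set.subset_union_left
  have hmem : ∀ φ, ∃ n, φ ∈ N n := by
    intro φ
    induction φ with
    | bot => exact ⟨0, .inl rfl⟩
    | var n => exact ⟨0, .inr ⟨n, rfl⟩⟩
    | imp φ ψ ih₁ ih₂ =>
      obtain ⟨n, hn⟩ := ih₁
      obtain ⟨m, hm⟩ := ih₂
      exact ⟨max n m + 1, .inr (.inl ⟨φ, hmono (le_max_left n m) hn, ψ,
        hmono (le_max_right n m) hm, rfl⟩)⟩
    | box e φ ih =>
      obtain ⟨n, hn⟩ := ih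
      exact ⟨n + 1, .inr (.inr ⟨e, trivial, φ, hn, rfl⟩)⟩
  rw [← Set.countable_univ_iff]
  exact (Set.countable_iUnion hN).mono fun φ _ => Set.mem_iUnion.2 (hmem φ)

theorem countable_sharp (A : Type) [Countable A] : Countable (Sharp A) := by
  let f : A ⊕ (A × A) ⊕ (A × A) ⊕ A → Sharp A :=
    Sum.elim .base (Sum.elim (fun p => .comp p.1 p.2)
      (Sum.elim (fun p => .union p.1 p.2) .plus))
  refine Function.Surjective.countable (f := f) ?_
  rintro (e | ⟨e, c⟩ | ⟨e, c⟩ | e)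
  exacts [⟨.inl e, rfl⟩, ⟨.inr (.inl (e, c)), rfl⟩, ⟨.inr (.inr (.inl (e, c))), rfl⟩,
    ⟨.inr (.inr (.inr e)), rfl⟩]

theorem countable_iterAlphabet (A : Type) [h : Countable A] (n : ℕ) :
    Countable (IterAlphabet A n) := by
  induction n with
  | zero => exact h
  | succ n ih => exact countable_sharp _

/-! ### The finite model property -/

section Filtration

variable {A W Q : Type}

/-- The boxed subformulas of `φ`, as pairs of a modality and the truth set of its argument. -/
def boxArgs (R : A → W → W → Prop) (V : ℕ → W → Prop) : Formula A → Set (A × Set W)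
  | bot => ∅
  | var _ => ∅
  | imp φ ψ => boxArgs R V φ ∪ boxArgs R V ψ
  | box e φ => insert (e, {x | Sat R V φ x}) (boxArgs R V φ)

/-- The propositional letters of `φ`. -/
def letters : Formula A → Set ℕ
  | bot => ∅
  | var n => {n}
  | imp φ ψ => letters φ ∪ letters ψ
  | box _ φ => letters φ

theorem finite_boxArgs (R : A → W → W → Prop) (V : ℕ → W → Prop) (φ : Formula A) :
    (boxArgs R V φ).Finite := by
  induction φ with
  | bot => exact Set.finite_empty
  | var n => exact Set.finite_empty
  | imp φ ψ ih₁ ih₂ => exact ih₁.union ih₂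
  | box e φ ih => exact ih.insert _

theorem finite_letters (φ : Formula A) : (letters φ).Finite := by
  induction φ with
  | bot => exact Set.finite_empty
  | var n => exact Set.finite_singleton n
  | imp φ ψ ih₁ ih₂ => exact ih₁.union ih₂
  | box e φ ih => exact ih

theorem IsModalAlgebra.sat_mem {R : A → W → W → Prop} {D : Set (Set W)} (hD : IsModalAlgebra R D)
    {V : ℕ → W → Prop} (hV : ∀ n, {x | V n x} ∈ D) (φ : Formula A) : {x | Sat R V φ x} ∈ D := by
  induction φ with
  | bot => exact hD.empty
  | var n => exact hV n
  | imp φ ψ ih₁ ih₂ => exact hD.imp _ ih₁ _ ih₂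
  | box e φ ih => exact hD.box e _ ih

theorem IsModalAlgebra.boxArgs_mem {R : A → W → W → Prop} {D : Set (Set W)}
    (hD : IsModalAlgebra R D) {V : ℕ → W → Prop} (hV : ∀ n, {x | V n x} ∈ D) (φ : Formula A) :
    ∀ p ∈ boxArgs R V φ, p.2 ∈ D := by
  induction φ with
  | bot => exact fun p hp => hp.elim
  | var n => exact fun p hp => hp.elim
  | imp φ ψ ih₁ ih₂ => exact fun p hp => hp.elim (ih₁ p) (ih₂ p)
  | box e φ ih =>
    rintro p (rfl | hp)
    exacts [hD.sat_mem hV φ, ih p hp]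

/-- The filtration lemma. -/
theorem sat_filtration {R : A → W → W → Prop} {V : ℕ → W → Prop} {π : W → Q}
    (hπ : Function.Surjective π) {S : A → Q → Q → Prop} (φ : Formula A)
    (hS : IsFiltration R π (boxArgs R V φ) S)
    (hV : ∀ n ∈ letters φ, Saturated π {x | V n x}) (x : W) :
    Sat S (fun n q => ∃ y, π y = q ∧ V n y) φ (π x) ↔ Sat R V φ x := by
  induction φ generalizing x with
  | bot => rfl
  | var n => exact ⟨fun ⟨y, hy, h⟩ => hV n rfl y x hy h, fun h => ⟨x, rfl, h⟩⟩
  | imp φ ψ ih₁ ih₂ =>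
    exact imp_congr
      (ih₁ ⟨hS.min, fun p hp => hS.max p (.inl hp)⟩ (fun n hn => hV n (.inl hn)) x)
      (ih₂ ⟨hS.min, fun p hp => hS.max p (.inr hp)⟩ (fun n hn => hV n (.inr hn)) x)
  | box e φ ih =>
    have ih' := ih ⟨hS.min, fun p hp => hS.max p (.inr hp)⟩ hV
    constructor
    · exact fun h y hy => (ih' y).1 (h _ (hS.min e x y hy))
    · intro h q hq
      obtain ⟨y, rfl⟩ := hπ q
      exact (ih' y).2 (hS.max _ (.inl rfl) x y hq h)

/-- Finitely many members of a modal algebra are saturated in some finite definable quotient. -/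
theorem IsModalAlgebra.exists_quotient {R : A → W → W → Prop} {D : Set (Set W)}
    (hD : IsModalAlgebra R D) {H : Set (Set W)} (hH : H.Finite) (hHD : H ⊆ D) :
    ∃ (Q : Type) (_ : Finite Q) (π : W → Q), Function.Surjective π ∧ (∀ q, π ⁻¹' {q} ∈ D) ∧
      ∀ X ∈ H, Saturated π X := by
  have := hH.to_subtype
  -- Points are classified by the members of `H` containing them; each fibre is a finite
  -- intersection of members of `H` and complements of members.
  let τ : W → H → Prop := fun x X => x ∈ X.1
  refine ⟨Set.range τ, inferInstance, Set.rangeFactorization τ,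
    Set.rangeFactorization_surjective, ?_, ?_⟩
  · intro q
    have hX : ∀ X : H, {x | x ∈ X.1 ↔ q.1 X} ∈ D := by
      intro X
      by_cases hq : q.1 X
      · simpa [hq] using hHD X.2
      · simp only [hq, iff_false]
        exact hD.compl (hHD X.2)
    convert hD.biInter Set.finite_univ hX using 1
    ext x
    simp only [Set.mem_preimage, Set.mem_singleton_iff, Set.mem_iInter, Set.mem_univ,
      Set.mem_ofPred_eq, forall_true_left, Subtype.ext_iff, funext_iff]
    exact forall_congr' fun X => eq_iff_iff
  · intro X hX x y hxy hx
    have := congrFun (congrArg Subtype.val hxy) ⟨X, hX⟩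
    exact (eq_iff_iff.1 this).1 hx

end Filtration

/-- The class of all finite frames for `L` serves. Countability of the alphabet makes the algebra of
definable sets countable, as `Filtrable` demands. -/
theorem hasFMP_of_filtrable {A : Type} [Countable A] {L : Set (Formula A)}
    (hL : IsNormalLogic L) (hf : Filtrable L) : HasFMP L := by
  refine ⟨{F | Finite F.W ∧ ∀ φ ∈ L, F.Valid φ}, fun F hF => hF.1,
    Set.Subset.antisymm (fun φ hφ F hF => hF.2 φ hφ) fun φ hφ => ?_⟩
  by_contra hφL
  obtain ⟨x₀, -, hx₀⟩ := exists_canonPoint hL subset_rfl hL.mp hφL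
  have := countable_formula A
  have : Nonempty (CanonPoint L) := ⟨x₀⟩
  let R := canonRel L
  let V : ℕ → CanonPoint L → Prop := fun n x => var n ∈ x.carrier
  have hD := isModalAlgebra_canonAlgebra hL
  have hV : ∀ n, {x | V n x} ∈ canonAlgebra L := fun n => ⟨var n, rfl⟩
  obtain ⟨H, hfin, hHD, hH⟩ := hf _ R _ hD (Set.countable_range _)
    (generalValid_canonAlgebra hL) (boxArgs R V φ) (finite_boxArgs R V φ) (hD.boxArgs_mem hV φ)
  -- The quotient must respect `H`, and also the letters of `φ` for the filtration lemma.
  obtain ⟨Q, _, π, hπ, hfib, hsat⟩ := hD.exists_quotient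
    (hfin.union ((finite_letters φ).image fun n => {x | V n x}))
    (Set.union_subset hHD (Set.image_subset_iff.2 fun n _ => hV n))
  obtain ⟨S, hS, hSL⟩ := hH Q π hπ hfib fun X hX => hsat X (.inl hX)
  have hsubst : φ.subst var = φ := by
    clear * -
    induction φ with
    | bot => rfl
    | var n => rfl
    | imp φ ψ ih₁ ih₂ => simp only [Formula.subst, ih₁, ih₂]
    | box e φ ih => simp only [Formula.subst, ih]
  have hval := hφ ⟨Q, ⟨π x₀⟩, S⟩ ⟨‹_›, hSL⟩ (fun n q => ∃ y, π y = q ∧ V n y) (π x₀)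
  have hsat₀ := (sat_filtration hπ φ hS (fun n hn => hsat _ (.inr ⟨n, hn, rfl⟩)) x₀).1 hval
  exact hx₀ (hsubst ▸ (sat_canonRel hL var φ x₀).1 hsat₀)

theorem filtrable_iterLogic {A : Type} {L : Set (Formula A)} (hL : Filtrable L) (n : ℕ) :
    Filtrable (iterLogic L n) := by
  induction n with
  | zero => exact hL
  | succ n ih => exact filtrable_sharpLogic ih

theorem isNormalLogic_iterLogic {A : Type} {L : Set (Formula A)} (hL : IsNormalLogic L) (n : ℕ) :
    IsNormalLogic (iterLogic L n) := by
  cases n with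
  | zero => exact hL
  | succ n => exact isNormalLogic_leastLogic _

end PDLization

theorem mainTheorem9 (k : ℕ) (A : Fin k → Type) [∀ i, Finite (A i)]
    (L : ∀ i, Set (PDLization.Formula (A i)))
    (hL : ∀ i, PDLization.IsBasicUnimodal (L i) ∨ PDLization.IsCanonicalMFPLogic (L i))
    (n : ℕ) :
    PDLization.HasFMP (PDLization.iterLogic (PDLization.fusion L) n) := by
  have := PDLization.countable_iterAlphabet ((i : Fin k) × A i) n
  exact PDLization.hasFMP_of_filtrable
    (PDLization.isNormalLogic_iterLogic (PDLization.isNormalLogic_leastLogic _) n)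
    (PDLization.filtrable_iterLogic (PDLization.filtrable_fusion fun i =>
      (hL i).elim PDLization.filtrable_of_isBasicUnimodal
        PDLization.filtrable_of_isCanonicalMFPLogic) n)
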